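/- **Theorem.** Let $\mathfrak{G}$ be the Grigorchuk group, i.e. the group of automorphisms of the rooted binary tree generated by $a,b,c,d$, where $a$ exchanges the two subtrees at the root, and $b,c,d$ fix the first level and act on the two subtrees by $b=(a,c)$, $c=(a,d)$, $d=(1,b)$. Then: 1. $\mathfrak{G}$ is densely related. That is, $\mathfrak{G}$ is finitely generated and, for every finite generating subset $S$ of $\mathfrak{G}$, there exists $c>0$ such that $\mathcal{R}_S(\mathfrak{G})\cap[n,cn]\neq\emptyset$ for every integer $n\ge 1$. Here, writing $F_S$ for the free group on $S$ and $N_n$ for the normal subgroup of $F_S$ generated by the elements of length at most $n$ of the kernel of $F_S\twoheadrightarrow\mathfrak{G}$ (so $N_{-1}=1$), the relation range $\mathcal{R}_S(\mathfrak{G})$ is the set of integers $n\ge 0$ such that $N_n$ properly contains $N_{n-1}$. 2. In particular, no asymptotic cone of $\mathfrak{G}$ is simply connected. That is, for every finite generating subset $S$ of $\mathfrak{G}$ with word metric $d_S(g,h)=|g^{-1}h|_S$, every ultrafilter $\omega$ on $\mathbf{N}$, every sequence $(s_n)$ of positive real numbers with $\lim_\omega s_n=+\infty$, and every sequence $(e_n)$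 of base points in $\mathfrak{G}$, the space $\mathrm{Cone}^\omega\big((\mathfrak{G},d_S),(e_n),(s_n)\big)$ is not simply connected. This cone is the set of sequences $(x_n)$ in $\mathfrak{G}$ for which $d_S(x_n,e_n)/s_n$ is bounded along $\omega$, with the distance $\lim_\omega d_S(x_n,y_n)/s_n$, where sequences at distance $0$ are identified. -/

import Mathlib

open Filter Topology

/-! ### The Grigorchuk group -/

/-- The states of the five-state automaton generating the Grigorchuk group. -/
inductive GrigorchukState : Type
  | one | a | b | c | d

/-- The action of the states on the vertices of the rooted binary tree, a vertex being a finite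
word in two letters (`false` is the letter 0 and `true` the letter 1): `a` exchanges the two
subtrees at the root, and `b = (a, c)`, `c = (a, d)`, `d = (1, b)` fix the first level. -/
def GrigorchukState.act : GrigorchukState → List Bool → List Bool
  | _, [] => []
  | .one, x :: w => x :: w
  | .a, x :: w => (!x) :: w
  | .b, false :: w => false :: act .a w
  | .b, true :: w => true :: act .c w
  | .c, false :: w => false :: act .a w
  | .c, true :: w => true :: act .d w
  | .d, false :: w => false :: act .one w
  | .d, true :: w => true :: act .b w

theorem GrigorchukState.act_involutive (q : GrigorchukState) :
    Function.Involutive q.act := by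
  intro w
  induction w generalizing q with
  | nil => cases q <;> simp [act]
  | cons x w ih => cases q <;> cases x <;> simp [act, ih]

/-- The permutation of the vertices of the binary tree defined by a state. -/
def GrigorchukState.perm (q : GrigorchukState) : Equiv.Perm (List Bool) :=
  q.act_involutive.toPerm

/-- The Grigorchuk group: the group of automorphisms of the rooted binary tree generated by
`a`, `b`, `c`, `d`. -/
def grigorchukGroup : Subgroup (Equiv.Perm (List Bool)) :=
  Subgroup.closure {GrigorchukState.a.perm, GrigorchukState.b.perm,
    GrigorchukState.c.perm, GrigorchukState.d.perm}

/-! ### The relation range -/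

section RelationRange

variable {G : Type*} [Group G]

/-- The natural homomorphism from the free group on `S` to `G`. -/
def evalHom (S : Set G) : FreeGroup S →* G := FreeGroup.lift ((↑) : S → G)

open Classical in
/-- The length of an element of the free group on `S` (the length of its reduced word). -/
noncomputable def freeLength {S : Set G} (w : FreeGroup S) : ℕ := FreeGroup.norm w

/-- The normal subgroup `N_n` of the free group on `S` generated by the relations of length at
most `n`. The index is an integer, so that `N_{-1}` is the trivial subgroup. -/
def relationSubgroup (S : Set G) (n : ℤ) : Subgroup (FreeGroup S) :=
  Subgroup.normalClosure {w | w ∈ (evalHom S).ker ∧ (freeLength w : ℤ) ≤ n}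

/-- The relation range of `G` with respect to `S`: the integers `n ≥ 0` such that `N_n` properly
contains `N_{n-1}`. -/
def relationRange (S : Set G) : Set ℕ :=
  {n | relationSubgroup S ((n : ℤ) - 1) < relationSubgroup S (n : ℤ)}

/-- There is `c > 0` such that the relation range with respect to `S` meets `[n, c n]` for every
`n ≥ 1`. -/
def IsDenselyRelatedOver (S : Set G) : Prop :=
  ∃ c : ℝ, 0 < c ∧ ∀ n : ℕ, 1 ≤ n →
    ∃ m ∈ relationRange S, (n : ℝ) ≤ (m : ℝ) ∧ (m : ℝ) ≤ c * (n : ℝ)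

variable (G) in
/-- A finitely generated group is densely related if it is so over every finite generating
subset. -/
def IsDenselyRelated : Prop :=
  Group.FG G ∧
    ∀ S : Set G, S.Finite → Subgroup.closure S = ⊤ → IsDenselyRelatedOver S

end RelationRange

/-! ### The word metric -/

section WordMetric

variable {G : Type*} [Group G]

theorem evalHom_surjective {S : Set G} (hS : Subgroup.closure S = ⊤) :
    Function.Surjective (evalHom S) := by
  rw [← MonoidHom.range_eq_top, evalHom, FreeGroup.range_lift_eq_closure, Subtype.range_coe, hS]

/-- The word length on `G`: the least length of an element of the free group on `S` that
represents `g`. -/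
noncomputable def wordLength (S : Set G) (g : G) : ℕ :=
  sInf {n | ∃ w : FreeGroup S, evalHom S w = g ∧ freeLength w = n}

theorem exists_freeLength_eq {S : Set G} (hS : Subgroup.closure S = ⊤) (g : G) :
    ∃ w : FreeGroup S, evalHom S w = g ∧ freeLength w = wordLength S g := by
  obtain ⟨w, hw⟩ := evalHom_surjective hS g
  exact Nat.sInf_mem (s := {n | ∃ w : FreeGroup S, evalHom S w = g ∧ freeLength w = n})
    ⟨_, w, hw, rfl⟩

theorem wordLength_le {S : Set G} (w : FreeGroup S) :
    wordLength S (evalHom S w) ≤ freeLength w :=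
  Nat.sInf_le ⟨w, rfl, rfl⟩

theorem wordLength_one (S : Set G) : wordLength S 1 = 0 := by
  have h := wordLength_le (S := S) 1
  simpa [freeLength] using h

theorem wordLength_inv_le {S : Set G} (hS : Subgroup.closure S = ⊤) (g : G) :
    wordLength S g⁻¹ ≤ wordLength S g := by
  obtain ⟨w, rfl, hw⟩ := exists_freeLength_eq hS g
  rw [← hw, ← map_inv]
  exact (wordLength_le _).trans (by simp [freeLength])

theorem wordLength_mul_le {S : Set G} (hS : Subgroup.closure S = ⊤) (g h : G) :
    wordLength S (g * h) ≤ wordLength S g + wordLength S h := by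
  obtain ⟨v, rfl, hv⟩ := exists_freeLength_eq hS g
  obtain ⟨w, rfl, hw⟩ := exists_freeLength_eq hS h
  rw [← hv, ← hw, ← map_mul]
  classical
  refine (wordLength_le _).trans ?_
  unfold freeLength
  convert FreeGroup.norm_mul_le v w

theorem eq_one_of_wordLength_eq_zero {S : Set G} (hS : Subgroup.closure S = ⊤) {g : G}
    (h : wordLength S g = 0) : g = 1 := by
  obtain ⟨w, rfl, hw⟩ := exists_freeLength_eq hS g
  rw [h] at hw
  have : w = 1 := by simpa [freeLength] using hw
  simp [this]

/-- The group `G`, regarded as a metric space with the word metric `d_S(g, h) = |g⁻¹ h|_S` of a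
generating subset `S`. -/
def WordMetricSpace (S : Set G) (_hS : Subgroup.closure S = ⊤) : Type _ := G

noncomputable instance (S : Set G) (hS : Subgroup.closure S = ⊤) :
    MetricSpace (WordMetricSpace S hS) where
  dist g h := (wordLength S ((show G from g)⁻¹ * (show G from h)) : ℝ)
  dist_self g := by
    rw [inv_mul_cancel, wordLength_one, Nat.cast_zero]
  dist_comm g h := by
    have key : ∀ x y : G, wordLength S (x⁻¹ * y) ≤ wordLength S (y⁻¹ * x) := fun x y => by
      simpa using wordLength_inv_le hS (y⁻¹ * x)
    exact congrArg _ (le_antisymm (key g h) (key h g))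
  dist_triangle g h k := by
    have key : ∀ x y z : G,
        wordLength S (x⁻¹ * z) ≤ wordLength S (x⁻¹ * y) + wordLength S (y⁻¹ * z) := fun x y z => by
      simpa [mul_assoc] using wordLength_mul_le hS (x⁻¹ * y) (y⁻¹ * z)
    exact_mod_cast key g h k
  eq_of_dist_eq_zero {g h} hgh := by
    have key : ∀ x y : G, wordLength S (x⁻¹ * y) = 0 → x = y := fun x y hxy =>
      inv_mul_eq_one.mp (eq_one_of_wordLength_eq_zero hS hxy)
    exact key g h (by exact_mod_cast hgh)

end WordMetric

/-! ### Asymptotic cones -/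

/-- The sequences in `X` at bounded distance from the sequence of base points `e`, for the metrics
`dist / s n` and along the ultrafilter `ω`. -/
structure ConeSequence {X : Type*} [PseudoMetricSpace X] (ω : Ultrafilter ℕ) (e : ℕ → X)
    (s : ℕ → ℝ) (hs : ∀ n, 0 < s n) where
  /-- The underlying sequence. -/
  seq : ℕ → X
  bounded : ∃ C : ℝ, ∀ᶠ n in (ω : Filter ℕ), dist (seq n) (e n) / s n ≤ C

namespace ConeSequence

variable {X : Type*} [PseudoMetricSpace X] {ω : Ultrafilter ℕ} {e : ℕ → X} {s : ℕ → ℝ}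
  {hs : ∀ n, 0 < s n}

/-- The limit along `ω` of the rescaled distances. -/
noncomputable def coneDist (x y : ConeSequence ω e s hs) : ℝ :=
  limUnder (ω : Filter ℕ) fun n => dist (x.seq n) (y.seq n) / s n

theorem tendsto_coneDist (x y : ConeSequence ω e s hs) :
    Tendsto (fun n => dist (x.seq n) (y.seq n) / s n) ω (𝓝 (coneDist x y)) := by
  apply tendsto_nhds_limUnder
  obtain ⟨C, hC⟩ := x.bounded
  obtain ⟨D, hD⟩ := y.bounded
  have hmem : ∀ᶠ n in (ω : Filter ℕ),
      dist (x.seq n) (y.seq n) / s n ∈ Set.Icc (0 : ℝ) (C + D) := by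
    filter_upwards [hC, hD] with n h1 h2
    refine ⟨div_nonneg dist_nonneg (hs n).le, ?_⟩
    calc dist (x.seq n) (y.seq n) / s n
        ≤ (dist (x.seq n) (e n) + dist (y.seq n) (e n)) / s n :=
          div_le_div_of_nonneg_right (dist_triangle_right _ _ _) (hs n).le
      _ ≤ C + D := by rw [add_div]; exact add_le_add h1 h2
  have hle : ((ω.map fun n => dist (x.seq n) (y.seq n) / s n : Ultrafilter ℝ) : Filter ℝ)
      ≤ 𝓟 (Set.Icc (0 : ℝ) (C + D)) := le_principal_iff.mpr hmem
  obtain ⟨l, -, hl⟩ := isCompact_Icc.ultrafilter_le_nhds _ hle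
  exact ⟨l, hl⟩

noncomputable instance : PseudoMetricSpace (ConeSequence ω e s hs) where
  dist := coneDist
  dist_self x := tendsto_nhds_unique (tendsto_coneDist x x) (by simp)
  dist_comm x y := tendsto_nhds_unique (tendsto_coneDist x y)
    (by simpa only [dist_comm] using tendsto_coneDist y x)
  dist_triangle x y z :=
    le_of_tendsto_of_tendsto (tendsto_coneDist x z)
      ((tendsto_coneDist x y).add (tendsto_coneDist y z))
      (Eventually.of_forall fun n => by
        change dist (x.seq n) (z.seq n) / s n
          ≤ dist (x.seq n) (y.seq n) / s n + dist (y.seq n) (z.seq n) / s n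
        rw [← add_div]
        exact div_le_div_of_nonneg_right (dist_triangle _ _ _) (hs n).le)

end ConeSequence

/-- The asymptotic cone `Cone^ω(X, (e n), (s n))`: the metric space of the sequences above, modulo
the relation of being at distance zero. -/
abbrev AsymptoticCone {X : Type*} [PseudoMetricSpace X] (ω : Ultrafilter ℕ) (e : ℕ → X)
    (s : ℕ → ℝ) (hs : ∀ n, 0 < s n) : Type _ :=
  SeparationQuotient (ConeSequence ω e s hs)

/-! Both statements follow from one fact (`grigorchukGroup.exists_relation`): there is a constant
`c` such that, at every scale `n`, some relation of length at most `c * n` is not a consequence of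
relations of length at most `n`.

To detect such relations, the group is approximated by groups in which short relations still hold.
At level 0, `a` and `d` generate a dihedral group of order 16, so `(ad)^4 ≠ 1`, although `(ad)^4 =
1` in the Grigorchuk group. Level `k + 1` is obtained from level `k` by the wreath recursion.
Passing to sections halves the length of an alternating word, so every relation of length at most `2
^ k` holds at level `k` (`wordProd_levelPerm_eq_one`). The substitution `σ` of `subst` reproduces a
word on the right subtree and gives an element of `⟨a, d⟩`, dihedral of exponent 4, on the left one.
Hence `σ^k(ad)^4`, of length `8 * 2 ^ k`, is a relation (`wordProd_perm_substWord`) that fails at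
level `k` (`wordProd_levelPerm_substWord`). A change of generators costs only constant factors.

For the cones, relations that are new at scale `s n` are rescaled to a limit loop. A null-homotopy
of it, cut into a fine finite grid and lifted to the group for a suitable `n`, would fill the
relation by squares of perimeter at most `⌊s n⌋₊` (`eq_of_grid`), so that it would follow from
relations of that length. -/

namespace GrigorchukState

/-! ### Words in the states and the wreath recursion -/

/-- The product of the values of `f` along a word in the states. -/
def wordProd {H : Type*} [Monoid H] (f : GrigorchukState → H) (w : List GrigorchukState) : H :=
  (w.map f).prod

section wordProd

variable {H : Type*} [Monoid H] (f : GrigorchukState → H)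

@[simp] theorem wordProd_nil : wordProd f [] = 1 := rfl

@[simp] theorem wordProd_cons (q : GrigorchukState) (w : List GrigorchukState) :
    wordProd f (q :: w) = f q * wordProd f w := by simp [wordProd]

@[simp] theorem wordProd_append (v w : List GrigorchukState) :
    wordProd f (v ++ w) = wordProd f v * wordProd f w := by simp [wordProd]

end wordProd

/-- The action of a state on the first letter. -/
def flip : GrigorchukState → Bool → Bool
  | .a, x => !x
  | _, x => x

/-- The state by which a state acts on the subtree below the letter. -/
def sect : GrigorchukState → Bool → GrigorchukState
  | .b, false => .a
  | .b, true => .c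
  | .c, false => .a
  | .c, true => .d
  | .d, true => .b
  | _, _ => .one

@[simp] theorem flip_flip (q : GrigorchukState) (x : Bool) : q.flip (q.flip x) = x := by
  cases q <;> simp [flip]

@[simp] theorem sect_flip (q : GrigorchukState) (x : Bool) : q.sect (q.flip x) = q.sect x := by
  cases q <;> cases x <;> simp [flip, sect]

@[simp] theorem act_nil (q : GrigorchukState) : q.act [] = [] := by cases q <;> simp [act]

@[simp] theorem act_one (w : List Bool) : act .one w = w := by cases w <;> simp [act]

theorem act_cons (q : GrigorchukState) (x : Bool) (w : List Bool) :
    q.act (x :: w) = q.flip x :: (q.sect x).act w := by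
  cases q <;> cases x <;> simp [act, flip, sect]

@[simp] theorem perm_apply (q : GrigorchukState) (w : List Bool) : q.perm w = q.act w := rfl

/-- The wreath recursion of the Grigorchuk group, over an arbitrary action of the states. -/
def wreath {X : Type*} (f : GrigorchukState → Equiv.Perm X) (q : GrigorchukState) :
    Equiv.Perm (Bool × X) where
  toFun p := (q.flip p.1, f (q.sect p.1) p.2)
  invFun p := (q.flip p.1, (f (q.sect p.1))⁻¹ p.2)
  left_inv p := by simp
  right_inv p := by simp

@[simp] theorem wreath_apply {X : Type*} (f : GrigorchukState → Equiv.Perm X)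
    (q : GrigorchukState) (x : Bool) (v : X) :
    wreath f q (x, v) = (q.flip x, f (q.sect x) v) := rfl

/-- The multiplication of the four-group `{1, b, c, d}`. -/
def kleinMul : GrigorchukState → GrigorchukState → GrigorchukState
  | .one, q => q
  | q, .one => q
  | .b, .c => .d
  | .c, .b => .d
  | .b, .d => .c
  | .d, .b => .c
  | .c, .d => .b
  | .d, .c => .b
  | _, _ => .one

/-- The map `f` satisfies the relations of the free product of `{1, a}` and of the four-group
`{1, b, c, d}`. -/
structure IsFreeProductMap {H : Type*} [Monoid H] (f : GrigorchukState → H) : Prop where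
  map_one : f .one = 1
  map_a : f .a * f .a = 1
  map_klein : ∀ p q, p ≠ .a → q ≠ .a → f p * f q = f (kleinMul p q)

namespace IsFreeProductMap

theorem mul_self {H : Type*} [Monoid H] {f : GrigorchukState → H} (hf : IsFreeProductMap f)
    (q : GrigorchukState) : f q * f q = 1 := by
  cases q
  · simp [hf.map_one]
  · exact hf.map_a
  all_goals
    rw [hf.map_klein _ _ (by simp) (by simp)]
    exact hf.map_one

theorem inv_eq {H : Type*} [Group H] {f : GrigorchukState → H} (hf : IsFreeProductMap f)
    (q : GrigorchukState) : (f q)⁻¹ = f q :=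
  inv_eq_of_mul_eq_one_left (hf.mul_self q)

theorem wordProd_reverse {H : Type*} [Group H] {f : GrigorchukState → H}
    (hf : IsFreeProductMap f) (w : List GrigorchukState) :
    wordProd f w.reverse = (wordProd f w)⁻¹ := by
  induction w with
  | nil => simp
  | cons q w ih => simp [ih, hf.inv_eq]

/-- The left sections of `b, c, d` are `a, a, 1` and the right ones are `c, d, b`; both assignments
respect the multiplication of the four-group. Hence alternating forms of words may be used at every
level. -/
theorem wreath {X : Type*} {f : GrigorchukState → Equiv.Perm X} (hf : IsFreeProductMap f) :
    IsFreeProductMap (wreath f) where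
  map_one := by
    ext1 ⟨x, v⟩
    simp [flip, sect, hf.map_one]
  map_a := by
    ext1 ⟨x, v⟩
    simp [flip, sect, hf.map_one]
  map_klein p q hp hq := by
    have h (p q : GrigorchukState) (hp : p ≠ .a) (hq : q ≠ .a) (v : X) :
        f p (f q v) = f (kleinMul p q) v := by rw [← hf.map_klein p q hp hq]; rfl
    have ha (v : X) : f .a (f .a v) = v := by rw [← Equiv.Perm.mul_apply, hf.map_a]; rfl
    ext1 ⟨x, v⟩
    cases p <;> cases q <;> first | contradiction | skip
    all_goals cases x
    all_goals simp [flip, sect, kleinMul, hf.map_one, h, ha]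

end IsFreeProductMap

theorem act_klein (p q : GrigorchukState) (hp : p ≠ .a) (hq : q ≠ .a) (w : List Bool) :
    p.act (q.act w) = (kleinMul p q).act w := by
  induction w generalizing p q with
  | nil => simp
  | cons x w ih =>
    have ha : act .a (act .a w) = w := act_involutive .a w
    cases p <;> cases q <;> first | contradiction | skip
    all_goals cases x
    all_goals simp [act_cons, flip, sect, kleinMul, ih, ha]

theorem isFreeProductMap_perm : IsFreeProductMap perm where
  map_one := by ext1 w; simp
  map_a := by ext1 w; exact act_involutive .a w
  map_klein p q hp hq := by ext1 w; exact act_klein p q hp hq w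

/-! ### Sections and contraction -/

/-- The action of a word on the first letter. -/
def wordFlip (w : List GrigorchukState) (x : Bool) : Bool := w.foldr flip x

open Classical in
/-- The word by which a word acts on the subtree below a letter. -/
noncomputable def wordSect : List GrigorchukState → Bool → List GrigorchukState
  | [], _ => []
  | q :: w, x => if q = .a then wordSect w x else q.sect (wordFlip w x) :: wordSect w x

theorem wordProd_wreath {X : Type*} {f : GrigorchukState → Equiv.Perm X} (hf : f .one = 1)
    (w : List GrigorchukState) (x : Bool) (v : X) :
    wordProd (wreath f) w (x, v) = (wordFlip w x, wordProd f (wordSect w x) v) := by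
  induction w with
  | nil => simp [wordFlip, wordSect]
  | cons q w ih =>
    by_cases h : q = .a
    · subst h
      simp [ih, wordFlip, wordSect, sect, hf]
    · simp [ih, wordFlip, wordSect, h]

theorem wordProd_perm_cons (w : List GrigorchukState) (x : Bool) (v : List Bool) :
    wordProd perm w (x :: v) = wordFlip w x :: wordProd perm (wordSect w x) v := by
  induction w with
  | nil => simp [wordFlip, wordSect]
  | cons q w ih =>
    by_cases h : q = .a
    · subst h
      simp [ih, wordFlip, wordSect, sect, act_cons]
    · simp [ih, wordFlip, wordSect, act_cons, h]

/-- A word is alternating if exactly one of any two consecutive states is `a`. -/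
def IsAlternating (w : List GrigorchukState) : Prop :=
  w.IsChain fun p q => p = .a ↔ q ≠ .a

/-- The alternating form depends only on the word, not on `f`, so a single replacement serves the
Grigorchuk group and its approximation at once. The state `one` counts as a letter different from
`a`, so products in the four-group need no further cancellation. -/
theorem exists_isAlternating (w : List GrigorchukState) :
    ∃ w' : List GrigorchukState, IsAlternating w' ∧ w'.length ≤ w.length ∧
      ∀ (H : Type) [Monoid H] (f : GrigorchukState → H), IsFreeProductMap f →
        wordProd f w' = wordProd f w := by
  induction w with
  | nil => exact ⟨[], .nil, le_rfl, fun _ _ _ _ => rfl⟩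
  | cons q w ih =>
    obtain ⟨w', hw', hl, hf⟩ := ih
    cases w' with
    | nil =>
      refine ⟨[q], .singleton _, by simp, fun H _ f h => ?_⟩
      simp [← hf H f h]
    | cons p t =>
      by_cases hp : p = .a <;> by_cases hq : q = .a
      · refine ⟨t, hw'.tail, by simp at hl ⊢; omega, fun H _ f h => ?_⟩
        rw [wordProd_cons, ← hf H f h, wordProd_cons, ← mul_assoc, hp, hq, h.map_a, one_mul]
      · refine ⟨q :: p :: t, hw'.cons_cons (by simp [hp, hq]), by simpa using hl,
          fun H _ f h => ?_⟩
        rw [wordProd_cons, hf H f h, wordProd_cons]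
      · refine ⟨q :: p :: t, hw'.cons_cons (by simp [hp, hq]), by simpa using hl,
          fun H _ f h => ?_⟩
        rw [wordProd_cons, hf H f h, wordProd_cons]
      · refine ⟨kleinMul q p :: t, ?_, by simp at hl ⊢; omega, fun H _ f h => ?_⟩
        · have hm : kleinMul q p ≠ .a := by
            cases p <;> cases q <;> simp_all [kleinMul]
          cases t with
          | nil => exact .singleton _
          | cons r t =>
            have := List.isChain_cons_cons.1 hw'
            exact this.2.cons_cons (by simpa [hm, hp] using this.1)
        · rw [wordProd_cons f q, ← hf H f h, wordProd_cons, wordProd_cons, ← mul_assoc,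
            h.map_klein q p hq hp]

/-- Only the letters different from `a` contribute to a section, and in an alternating word they are
every other letter. -/
theorem IsAlternating.length_wordSect {w : List GrigorchukState} (hw : IsAlternating w)
    (x : Bool) : 2 * (wordSect w x).length ≤ w.length + 1 := by
  have key : ∀ w : List GrigorchukState, IsAlternating w →
      2 * (wordSect w x).length ≤ w.length + 1 ∧
      (w.head? = some .a → 2 * (wordSect w x).length ≤ w.length) := by
    intro w
    induction w with
    | nil => simp [wordSect]
    | cons q t ih =>
      intro hw
      obtain ⟨h1, h2⟩ := ih hw.tail
      by_cases hq : q = .a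
      · subst hq
        simp only [wordSect, if_true, List.length_cons]
        exact ⟨by omega, fun _ => h1⟩
      · simp only [wordSect, hq, if_false, List.length_cons, List.head?_cons, Option.some.injEq,
          false_imp_iff, and_true]
        cases t with
        | nil => simp [wordSect]
        | cons r t =>
          have := (List.isChain_cons_cons.1 hw).1
          have hr : r = .a := by simpa [hq] using this
          have := h2 (by simp [hr])
          omega
  exact (key w hw).1

/-! ### Approximations of the Grigorchuk group -/

/-- The set on which the approximation of level `k` acts. -/
def LevelSet : ℕ → Type
  | 0 => ZMod 8 × Bool
  | k + 1 => Bool × LevelSet k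

/-- An action in which `a` and `d` generate a dihedral group of order 16. -/
def dihedralPerm : GrigorchukState → Equiv.Perm (ZMod 8 × Bool)
  | .one => 1
  -- The product `ad` translates `ZMod 8` by `-1`, so its order is 8; `b` acts on the other factor
  -- only and `c = bd`.
  | .a => (Equiv.neg _).prodCongr (Equiv.refl _)
  | .b => (Equiv.refl _).prodCongr Equiv.boolNot
  | .c => (Equiv.subLeft 1).prodCongr Equiv.boolNot
  | .d => (Equiv.subLeft 1).prodCongr (Equiv.refl _)

/-- The action of the states at level `k`. -/
def levelPerm : (k : ℕ) → GrigorchukState → Equiv.Perm (LevelSet k)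
  | 0 => dihedralPerm
  | k + 1 => wreath (levelPerm k)

theorem isFreeProductMap_dihedralPerm : IsFreeProductMap dihedralPerm where
  map_one := rfl
  map_a := by ext1 ⟨i, e⟩; simp [dihedralPerm]
  map_klein p q hp hq := by
    cases p <;> cases q <;> first | contradiction | skip
    all_goals ext1 ⟨i, e⟩
    all_goals simp [dihedralPerm, kleinMul]

theorem isFreeProductMap_levelPerm (k : ℕ) : IsFreeProductMap (levelPerm k) := by
  induction k with
  | zero => exact isFreeProductMap_dihedralPerm
  | succ k ih => exact ih.wreath

theorem eq_one_of_perm_eq_one {q : GrigorchukState} (h : q.perm = 1) : q = .one := by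
  have h1 := DFunLike.congr_fun h [false, false]
  have h2 := DFunLike.congr_fun h [true, false, false]
  rw [perm_apply] at h1 h2
  cases q <;> simp [act] at h1 h2 ⊢

/-- Contraction: the sections of a relation are relations of half the length, to which the previous
level applies. At level 0 the word has at most one letter. -/
theorem wordProd_levelPerm_eq_one {k : ℕ} {w : List GrigorchukState} (hk : w.length ≤ 2 ^ k)
    (hw : wordProd perm w = 1) : wordProd (levelPerm k) w = 1 := by
  induction k generalizing w with
  | zero =>
    match w, hk with
    | [], _ => rfl
    | [q], _ =>
      have : q = .one := eq_one_of_perm_eq_one (by simpa using hw)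
      simp [this, (isFreeProductMap_levelPerm 0).map_one]
  | succ k ih =>
    obtain ⟨w', halt, hl, hf⟩ := exists_isAlternating w
    rw [← hf _ _ isFreeProductMap_perm] at hw
    rw [← hf _ _ (isFreeProductMap_levelPerm (k + 1))]
    have h (x : Bool) (v : List Bool) :
        wordFlip w' x = x ∧ wordProd perm (wordSect w' x) v = v := by
      have := DFunLike.congr_fun hw (x :: v)
      rw [wordProd_perm_cons] at this
      simpa using this
    refine Equiv.ext fun ⟨x, v⟩ => ?_
    change wordProd (wreath (levelPerm k)) w' (x, v) = _
    -- The bound is `(2 ^ (k + 1) + 1) / 2`, and the extra half disappears because `2 ^ (k + 1)` is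
    -- even.
    have hlen : (wordSect w' x).length ≤ 2 ^ k := by
      have := halt.length_wordSect x
      rw [pow_succ] at hk
      omega
    rw [wordProd_wreath (isFreeProductMap_levelPerm k).map_one, (h x []).1,
      ih hlen (Equiv.ext fun v => (h x v).2)]
    rfl

/-! ### The substitution -/

/-- The substitution `a ↦ aca`, `b ↦ d`, `c ↦ b`, `d ↦ c`. -/
def subst : GrigorchukState → List GrigorchukState
  | .one => [.one]
  | .a => [.a, .c, .a]
  | .b => [.d]
  | .c => [.b]
  | .d => [.c]

/-- The action of the substituted state on the left subtree. -/
def coSubst : GrigorchukState → GrigorchukState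
  | .one => .one
  | .a => .d
  | .b => .one
  | .c => .a
  | .d => .a

/-- The right sections of `aca, d, b, c` are `a, b, c, d`. The left sections play no role at the
finite levels, where only non-triviality is needed. -/
theorem wordProd_wreath_subst {X : Type*} {f : GrigorchukState → Equiv.Perm X}
    (hf : f .one = 1) (w : List GrigorchukState) (v : X) :
    wordProd (wreath f) (w.flatMap subst) (true, v) = (true, wordProd f w v) := by
  induction w with
  | nil => simp
  | cons q w ih =>
    rw [List.flatMap_cons, wordProd_append, Equiv.Perm.mul_apply, ih]
    cases q <;> simp [subst, flip, sect, hf]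

theorem wordProd_perm_subst_true (w : List GrigorchukState) (v : List Bool) :
    wordProd perm (w.flatMap subst) (true :: v) = true :: wordProd perm w v := by
  induction w with
  | nil => simp
  | cons q w ih =>
    rw [List.flatMap_cons, wordProd_append, Equiv.Perm.mul_apply, ih]
    cases q <;> simp [subst, act]

theorem wordProd_perm_subst_false (w : List GrigorchukState) (v : List Bool) :
    wordProd perm (w.flatMap subst) (false :: v) =
      false :: wordProd perm (w.map coSubst) v := by
  induction w with
  | nil => simp
  | cons q w ih =>
    rw [List.flatMap_cons, wordProd_append, Equiv.Perm.mul_apply, ih]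
    cases q <;> simp [subst, act, coSubst]

/-! ### Fourth powers in dihedral groups and the relations obtained by substitution. -/

theorem perm_a_mul_perm_d_pow : (perm .a * perm .d) ^ 4 = 1 := by
  ext1 w
  have hb (w : List Bool) : act .b (act .b w) = w := act_involutive .b w
  rcases w with _ | ⟨_ | _, w⟩ <;> simp [pow_succ, act, hb]

/-- An element of the subgroup generated by two involutions `x` and `y` is a power of `x * y` or
a power of `x * y` times `x`. -/
theorem _root_.exists_eq_zpow_of_involutions {H : Type*} [Group H] {x y : H} (hx : x * x = 1)
    (hy : y * y = 1) (l : List H) (hl : ∀ g ∈ l, g = 1 ∨ g = x ∨ g = y) :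
    ∃ i : ℤ, l.prod = (x * y) ^ i ∨ l.prod = (x * y) ^ i * x := by
  have hx' : x⁻¹ = x := inv_eq_of_mul_eq_one_left hx
  have hy' : y⁻¹ = y := inv_eq_of_mul_eq_one_left hy
  have hconj (i : ℤ) : x * (x * y) ^ i = (x * y) ^ (-i) * x := by
    have h1 : x * (x * y) * x⁻¹ = (x * y)⁻¹ := by
      rw [← mul_assoc, hx, mul_inv_rev, hx', hy', one_mul]
    rw [zpow_neg, ← inv_zpow, ← h1, conj_zpow, inv_mul_cancel_right]
  have hy2 : y = x * (x * y) := by rw [← mul_assoc, hx, one_mul]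
  induction l with
  | nil => exact ⟨0, by simp⟩
  | cons g l ih =>
    obtain ⟨i, hi⟩ := ih fun g hg => hl g (List.mem_cons_of_mem _ hg)
    rw [List.prod_cons]
    have hyz : y * (x * y) ^ i = (x * y) ^ (-(1 + i)) * x := by
      rw [← hconj, zpow_add, zpow_one]
      nth_rw 1 [hy2]
      simp only [mul_assoc]
    rcases hl g (by simp) with rfl | rfl | rfl <;> rcases hi with hi | hi <;> rw [hi]
    · exact ⟨i, by simp⟩
    · exact ⟨i, by simp⟩
    · exact ⟨-i, .inr (hconj i)⟩
    · exact ⟨-i, .inl (by rw [← mul_assoc, hconj, mul_assoc, hx, mul_one])⟩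
    · exact ⟨-(1 + i), .inr hyz⟩
    · exact ⟨-(1 + i), .inl (by rw [← mul_assoc, hyz, mul_assoc, hx, mul_one])⟩

/-- Powers of `x * y` have trivial fourth power by hypothesis, and the remaining elements are
reflections, of square 1. -/
theorem _root_.prod_pow_four_of_involutions {H : Type*} [Group H] {x y : H} (hx : x * x = 1)
    (hy : y * y = 1) (hxy : (x * y) ^ 4 = 1) (l : List H)
    (hl : ∀ g ∈ l, g = 1 ∨ g = x ∨ g = y) : l.prod ^ 4 = 1 := by
  obtain ⟨i, hi | hi⟩ := exists_eq_zpow_of_involutions hx hy l hl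
  · rw [hi, ← zpow_natCast, ← zpow_mul, mul_comm, zpow_mul, zpow_natCast, hxy, one_zpow]
  · have hx' : x⁻¹ = x := inv_eq_of_mul_eq_one_left hx
    have hy' : y⁻¹ = y := inv_eq_of_mul_eq_one_left hy
    have h1 : x * (x * y) * x⁻¹ = (x * y)⁻¹ := by
      rw [← mul_assoc, hx, mul_inv_rev, hx', hy', one_mul]
    have h2 : l.prod ^ 2 = 1 := by
      have : x * (x * y) ^ i * x = ((x * y) ^ i)⁻¹ := by
        rw [← inv_zpow, ← h1, conj_zpow, hx']
      rw [pow_two, hi, mul_assoc, ← mul_assoc x, this, mul_inv_cancel]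
    rw [show 4 = 2 * 2 from rfl, pow_mul, h2, one_pow]

/-- The words whose fourth powers are new relations of the Grigorchuk group. -/
def substWord (k : ℕ) : List GrigorchukState := (List.flatMap subst)^[k] [.a, .d]

theorem substWord_succ (k : ℕ) : substWord (k + 1) = (substWord k).flatMap subst :=
  Function.iterate_succ_apply' _ _ _

theorem wordProd_perm_substWord (k : ℕ) : wordProd perm (substWord k) ^ 4 = 1 := by
  induction k with
  | zero => simpa [substWord] using perm_a_mul_perm_d_pow
  | succ k ih =>
    rw [substWord_succ]
    -- On the left subtree only `1`, `a` and `d` occur, so the fourth power vanishes there for every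
    -- word; the induction hypothesis is needed on the right subtree alone.
    have htau : wordProd perm ((substWord k).map coSubst) ^ 4 = 1 := by
      refine prod_pow_four_of_involutions (isFreeProductMap_perm.mul_self .a)
        (isFreeProductMap_perm.mul_self .d) perm_a_mul_perm_d_pow _ fun g hg => ?_
      simp only [List.mem_map] at hg
      obtain ⟨_, ⟨q, -, rfl⟩, rfl⟩ := hg
      cases q <;> simp [coSubst, isFreeProductMap_perm.map_one]
    ext1 v
    rcases v with _ | ⟨_ | _, v⟩
    · have (w : List GrigorchukState) : wordProd perm w [] = [] := by
        induction w with
        | nil => rfl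
        | cons q w ih => simp [ih]
      simp [pow_succ, this]
    · have := DFunLike.congr_fun htau v
      simp only [pow_succ, pow_zero, one_mul, Equiv.Perm.mul_apply, Equiv.Perm.one_apply,
        wordProd_perm_subst_false] at this ⊢
      rw [this]
    · have := DFunLike.congr_fun ih v
      simp only [pow_succ, pow_zero, one_mul, Equiv.Perm.mul_apply, Equiv.Perm.one_apply,
        wordProd_perm_subst_true] at this ⊢
      rw [this]

/-- At level 0 the fourth power moves `0` to `4` in `ZMod 8`; each further level contains the
previous one on its right subtree. -/
theorem wordProd_levelPerm_substWord (k : ℕ) :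
    wordProd (levelPerm k) (substWord k) ^ 4 ≠ 1 := by
  induction k with
  | zero =>
    intro h
    have := congrArg Prod.fst (DFunLike.congr_fun h ((0 : ZMod 8), false))
    simp [pow_succ, substWord, levelPerm] at this
    revert this
    decide
  | succ k ih =>
    contrapose! ih
    have h : wordProd (wreath (levelPerm k)) (substWord (k + 1)) ^ 4 = 1 := ih
    ext1 v
    have := congrArg Prod.snd (DFunLike.congr_fun h (true, v))
    rw [substWord_succ] at this
    simpa only [pow_succ, pow_zero, one_mul, Equiv.Perm.mul_apply,
      Equiv.Perm.one_apply, wordProd_wreath_subst (isFreeProductMap_levelPerm k).map_one] using this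

/-- Each `a` contributes two extra letters and doubles in number, while every other letter keeps
length 1. -/
theorem length_substWord (k : ℕ) : (substWord k).length = 2 ^ (k + 1) := by
  classical
  have key (w : List GrigorchukState) :
      (w.flatMap subst).count .a = 2 * w.count .a ∧
        (w.flatMap subst).length = w.length + 2 * w.count .a := by
    induction w with
    | nil => simp
    | cons q w ih =>
      rw [List.flatMap_cons, List.count_append, List.length_append, ih.1, ih.2]
      cases q <;> simp [subst] <;> omega
  have : (substWord k).count .a = 2 ^ k ∧ (substWord k).length = 2 ^ (k + 1) := by
    induction k with
    | zero => simp [substWord]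
    | succ k ih =>
      rw [substWord_succ, (key _).1, (key _).2, ih.1, ih.2]
      constructor <;> ring
  exact this.2

end GrigorchukState

/-! ### Lengths in free groups and gaps in the relation range -/

section FreeLength

variable {G : Type*} {S : Set G}

theorem freeLength_mk_le (L : List (S × Bool)) :
    freeLength (FreeGroup.mk L : FreeGroup S) ≤ L.length := by
  classical
  unfold freeLength
  convert FreeGroup.norm_mk_le (L₁ := L)

theorem exists_mk_eq (w : FreeGroup S) :
    ∃ L : List (S × Bool), FreeGroup.mk L = w ∧ L.length = freeLength w := by
  classical
  refine ⟨w.toWord, FreeGroup.mk_toWord, ?_⟩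
  unfold freeLength FreeGroup.norm
  convert rfl

theorem freeLength_one : freeLength (1 : FreeGroup S) = 0 := by simp [freeLength]

theorem freeLength_inv (w : FreeGroup S) : freeLength w⁻¹ = freeLength w := by simp [freeLength]

theorem freeLength_mul_le (v w : FreeGroup S) :
    freeLength (v * w) ≤ freeLength v + freeLength w := by
  classical
  unfold freeLength
  convert FreeGroup.norm_mul_le v w

theorem freeLength_pow_le (w : FreeGroup S) (n : ℕ) : freeLength (w ^ n) ≤ n * freeLength w := by
  induction n with
  | zero => simp [freeLength_one]
  | succ n ih =>
    rw [pow_succ, add_mul, one_mul]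
    exact (freeLength_mul_le _ _).trans (by omega)

theorem freeLength_prod_le (l : List (FreeGroup S)) (m : ℕ) (h : ∀ w ∈ l, freeLength w ≤ m) :
    freeLength l.prod ≤ l.length * m := by
  induction l with
  | nil => simp [freeLength_one]
  | cons w l ih =>
    rw [List.prod_cons, List.length_cons, add_mul, one_mul]
    have h1 := ih fun v hv => h v (List.mem_cons_of_mem _ hv)
    have h2 := h w (by simp)
    exact (freeLength_mul_le _ _).trans (by omega)

variable [Group G]

theorem relationSubgroup_mono (S : Set G) : Monotone (relationSubgroup S) := fun _ _ h =>
  Subgroup.normalClosure_mono fun _ hw => ⟨hw.1, hw.2.trans h⟩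

theorem mem_relationSubgroup {w : FreeGroup S} {n : ℤ} (hw : evalHom S w = 1)
    (hn : (freeLength w : ℤ) ≤ n) : w ∈ relationSubgroup S n :=
  Subgroup.subset_normalClosure ⟨hw, hn⟩

theorem exists_mem_relationRange {m n : ℕ} (hmn : m ≤ n)
    (h : relationSubgroup S (m : ℤ) ≠ relationSubgroup S (n : ℤ)) :
    ∃ k ∈ relationRange S, m < k ∧ k ≤ n := by
  contrapose! h
  induction n, hmn using Nat.le_induction with
  | base => rfl
  | succ n hmn ih =>
    rw [ih fun k hk hm => (h k hk hm).trans_le' n.le_succ]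
    refine (relationSubgroup_mono S (by simp)).eq_of_not_lt fun hlt => ?_
    have hmem : n + 1 ∈ relationRange S := by
      simpa [relationRange] using hlt
    exact absurd (h _ hmem (by omega)) (lt_irrefl _)

/-- If at every scale there is a relation that does not follow from relations of smaller size, then
the relation range has no large gap. -/
theorem isDenselyRelatedOver_of_exists_relation {c : ℕ}
    (h : ∀ n : ℕ, 1 ≤ n → ∃ w : FreeGroup S, evalHom S w = 1 ∧ freeLength w ≤ c * n ∧
      w ∉ relationSubgroup S (n : ℤ)) : IsDenselyRelatedOver S := by
  -- The constant `c + 1` makes the interval from `n` to `(c + 1) * n` meaningful even when `c = 0`.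
  refine ⟨c + 1, by positivity, fun n hn => ?_⟩
  obtain ⟨w, h1, hw, hmem⟩ := h n hn
  have hle : n ≤ (c + 1) * n := Nat.le_mul_of_pos_left n c.succ_pos
  obtain ⟨k, hk, hnk, hkc⟩ := exists_mem_relationRange (S := S) hle fun heq => hmem <| by
    rw [heq]
    refine mem_relationSubgroup h1 ?_
    rw [Nat.cast_le]
    exact hw.trans (Nat.mul_le_mul_right n c.le_succ)
  exact ⟨k, hk, by exact_mod_cast hnk.le, by exact_mod_cast hkc⟩

end FreeLength

/-! ### New relations of the Grigorchuk group -/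

namespace grigorchukGroup

open GrigorchukState

/-- The element of the Grigorchuk group defined by a state. -/
def gen (q : GrigorchukState) : grigorchukGroup :=
  ⟨q.perm, by
    cases q
    · rw [isFreeProductMap_perm.map_one]
      exact one_mem _
    all_goals exact Subgroup.subset_closure (by simp)⟩

theorem isFreeProductMap_gen : IsFreeProductMap gen where
  map_one := Subtype.ext isFreeProductMap_perm.map_one
  map_a := Subtype.ext isFreeProductMap_perm.map_a
  map_klein p q hp hq := Subtype.ext (isFreeProductMap_perm.map_klein p q hp hq)

theorem coe_wordProd_gen (w : List GrigorchukState) :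
    ((wordProd gen w : grigorchukGroup) : Equiv.Perm (List Bool)) = wordProd perm w := by
  induction w with
  | nil => rfl
  | cons q w ih => simp [ih, gen]

theorem wordProd_perm_eq_one_iff {w : List GrigorchukState} :
    wordProd perm w = 1 ↔ wordProd gen w = 1 := by
  rw [← coe_wordProd_gen, OneMemClass.coe_eq_one]

theorem exists_wordProd_eq (g : grigorchukGroup) : ∃ w, wordProd gen w = g := by
  obtain ⟨g, hg⟩ := g
  suffices ∃ w, wordProd perm w = g by
    obtain ⟨w, hw⟩ := this
    exact ⟨w, Subtype.ext ((coe_wordProd_gen w).trans hw)⟩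
  induction hg using Subgroup.closure_induction with
  | mem x hx =>
    simp only [Set.mem_insert_iff, Set.mem_singleton_iff] at hx
    rcases hx with rfl | rfl | rfl | rfl
    · exact ⟨[.a], by simp⟩
    · exact ⟨[.b], by simp⟩
    · exact ⟨[.c], by simp⟩
    · exact ⟨[.d], by simp⟩
  | one => exact ⟨[], rfl⟩
  | mul x y _ _ hx hy =>
    obtain ⟨v, rfl⟩ := hx
    obtain ⟨w, rfl⟩ := hy
    exact ⟨v ++ w, by simp⟩
  | inv x _ hx =>
    obtain ⟨w, rfl⟩ := hx
    exact ⟨w.reverse, isFreeProductMap_perm.wordProd_reverse w⟩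

instance : Group.FG grigorchukGroup :=
  (Group.fg_iff_subgroup_fg _).2
    ((Subgroup.fg_iff _).2 ⟨_, rfl, by simp⟩)

/-- A word in the states representing an element of the Grigorchuk group. -/
noncomputable def repr (g : grigorchukGroup) : List GrigorchukState :=
  (exists_wordProd_eq g).choose

theorem wordProd_repr (g : grigorchukGroup) : wordProd gen (repr g) = g :=
  (exists_wordProd_eq g).choose_spec

/-! ### Transfer to an arbitrary finite generating set. -/

variable {S : Set grigorchukGroup}

/-- The homomorphism from the free group on `S` obtained by writing the elements of `S` as words in
the states. -/
noncomputable def substHom (S : Set grigorchukGroup) {H : Type*} [Group H]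
    (f : GrigorchukState → H) : FreeGroup S →* H :=
  FreeGroup.lift fun s => wordProd f (repr s)

theorem substHom_gen : substHom S gen = evalHom S := by
  refine FreeGroup.ext_hom _ _ fun s => ?_
  simp [substHom, evalHom, wordProd_repr]

/-- The states are involutions, so the inverse of a generator is represented by the reversed word
and no inverse letters are needed. -/
theorem exists_word (w : FreeGroup S) {m : ℕ} (hm : ∀ s ∈ S, (repr s).length ≤ m) :
    ∃ v : List GrigorchukState, v.length ≤ m * freeLength w ∧
      ∀ (H : Type) [Group H] (f : GrigorchukState → H), IsFreeProductMap f →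
        wordProd f v = substHom S f w := by
  obtain ⟨L, rfl, hL⟩ := exists_mk_eq w
  rw [← hL]
  clear hL
  induction L with
  | nil => exact ⟨[], by simp, fun H _ f _ => by simp [substHom]⟩
  | cons p L ih =>
    obtain ⟨v, hv, hf⟩ := ih
    obtain ⟨⟨s, hs⟩, b⟩ := p
    have := hm s hs
    refine ⟨(if b then repr s else (repr s).reverse) ++ v, ?_, fun H _ f h => ?_⟩
    · rw [List.length_append, List.length_cons, mul_add, mul_one]
      have : (if b then repr s else (repr s).reverse).length ≤ m := by
        split_ifs <;> simpa
      omega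
    · rw [wordProd_append, hf H f h, substHom, FreeGroup.lift_mk, FreeGroup.lift_mk]
      cases b <;> simp [h.wordProd_reverse]

/-- A relation of length at most `n` holds at level `k` if `2 ^ k` is large. -/
theorem substHom_levelPerm_eq_one {m k : ℕ} (hm : ∀ s ∈ S, (repr s).length ≤ m)
    {w : FreeGroup S} (hw : evalHom S w = 1) (hk : m * freeLength w ≤ 2 ^ k) :
    substHom S (levelPerm k) w = 1 := by
  obtain ⟨v, hv, hf⟩ := exists_word w hm
  rw [← hf _ _ (isFreeProductMap_levelPerm k)]
  refine wordProd_levelPerm_eq_one (hv.trans hk) ?_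
  rw [wordProd_perm_eq_one_iff, hf _ _ isFreeProductMap_gen, substHom_gen, hw]

theorem substHom_levelPerm_eq {m k : ℕ} (hm : ∀ s ∈ S, (repr s).length ≤ m)
    {w : FreeGroup S} {q : GrigorchukState} (hw : evalHom S w = gen q)
    (hk : m * freeLength w + 1 ≤ 2 ^ k) : substHom S (levelPerm k) w = levelPerm k q := by
  obtain ⟨v, hv, hf⟩ := exists_word w hm
  rw [← hf _ _ (isFreeProductMap_levelPerm k), ← (isFreeProductMap_levelPerm k).inv_eq,
    eq_inv_iff_mul_eq_one]
  -- Since `q` is an involution, the equality becomes a relation with one more letter, whence the `+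
  -- 1` in `hk`.
  have : wordProd (levelPerm k) (v ++ [q]) = 1 := by
    refine wordProd_levelPerm_eq_one ((by simpa using hv.trans_lt hk)) ?_
    rw [wordProd_perm_eq_one_iff, wordProd_append, hf _ _ isFreeProductMap_gen, substHom_gen, hw]
    simpa using isFreeProductMap_gen.mul_self q
  simpa using this

theorem relationSubgroup_le_ker {m n k : ℕ} (hm : ∀ s ∈ S, (repr s).length ≤ m)
    (hk : m * n ≤ 2 ^ k) :
    relationSubgroup S (n : ℤ) ≤ (substHom S (levelPerm k)).ker :=
  Subgroup.normalClosure_le_normal fun w hw =>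
    substHom_levelPerm_eq_one hm hw.1
      ((Nat.mul_le_mul_left m (by exact_mod_cast hw.2)).trans hk)

/-- At every scale, the Grigorchuk group has a relation that does not follow from relations of
smaller size. -/
theorem exists_relation (hfin : S.Finite) (hS : Subgroup.closure S = ⊤) :
    ∃ c : ℕ, ∀ n : ℕ, 1 ≤ n → ∃ w : FreeGroup S, evalHom S w = 1 ∧ freeLength w ≤ c * n ∧
      w ∉ relationSubgroup S (n : ℤ) := by
  obtain ⟨m, hm⟩ : ∃ m, ∀ s ∈ S, (repr s).length ≤ m := by
    obtain ⟨m, hm⟩ := (hfin.image fun s => (repr s).length).bddAbove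
    exact ⟨m, fun s hs => hm ⟨s, hs, rfl⟩⟩
  choose v hv using fun q => evalHom_surjective hS (gen q)
  obtain ⟨l, hl⟩ : ∃ l, ∀ q, freeLength (v q) ≤ l := by
    refine ⟨freeLength (v .one) + freeLength (v .a) + freeLength (v .b) + freeLength (v .c) +
      freeLength (v .d), fun q => ?_⟩
    cases q <;> omega
  -- This `k₀` absorbs both `m ≤ 2 ^ k₀`, for killing the relations of length `n`, and `m * l + 1 ≤
  -- 2 ^ k₀`, for the words `v q` to have the right value at level `k`.
  obtain ⟨k₀, hk₀⟩ : ∃ k₀, m * (l + 1) + 1 ≤ 2 ^ k₀ := ⟨_, Nat.lt_two_pow_self⟩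
  refine ⟨8 * l * 2 ^ (k₀ + 1), fun n hn => ?_⟩
  set k := k₀ + (Nat.log 2 n + 1) with hkdef
  have hk1 : m * n ≤ 2 ^ k := by
    rw [hkdef, pow_add]
    refine Nat.mul_le_mul ?_ (Nat.lt_pow_succ_log_self one_lt_two n).le
    refine le_trans ?_ hk₀
    rw [mul_add]
    omega
  have hk2 : m * l + 1 ≤ 2 ^ k := by
    refine le_trans ?_ (Nat.pow_le_pow_right two_pos (Nat.le_add_right k₀ _))
    refine le_trans ?_ hk₀
    rw [mul_add]
    omega
  have hk3 : 2 ^ k ≤ 2 ^ (k₀ + 1) * n := by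
    rw [hkdef, show k₀ + (Nat.log 2 n + 1) = k₀ + 1 + Nat.log 2 n by ring, pow_add _ (k₀ + 1)]
    exact Nat.mul_le_mul_left _ (Nat.pow_log_le_self 2 (by omega))
  have hprod {H : Type} [Group H] {f : GrigorchukState → H} (φ : FreeGroup S →* H)
      (h : ∀ q, φ (v q) = f q) (w : List GrigorchukState) :
      φ (w.map v).prod = wordProd f w := by
    rw [map_list_prod, List.map_map, wordProd]
    congr 2
    exact funext h
  -- The relation `σ^k(ad)^4`, rewritten in the generators `S`.
  refine ⟨((substWord k).map v).prod ^ 4, ?_, ?_, fun hmem => ?_⟩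
  · rw [map_pow, hprod (f := gen) _ hv]
    refine Subtype.ext ?_
    rw [Subgroup.coe_pow, coe_wordProd_gen, wordProd_perm_substWord, Subgroup.coe_one]
  · calc _ ≤ 4 * freeLength ((substWord k).map v).prod := freeLength_pow_le _ _
      _ ≤ 4 * (2 ^ (k + 1) * l) := by
        refine Nat.mul_le_mul_left 4 ((freeLength_prod_le _ l ?_).trans_eq ?_)
        · simp only [List.mem_map]
          rintro _ ⟨q, -, rfl⟩
          exact hl q
        · rw [List.length_map, length_substWord]
      _ = 8 * l * 2 ^ k := by ring
      _ ≤ 8 * l * (2 ^ (k₀ + 1) * n) := Nat.mul_le_mul_left _ hk3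
      _ = _ := by ring
  · have := relationSubgroup_le_ker hm hk1 hmem
    rw [MonoidHom.mem_ker, map_pow, hprod (f := levelPerm k) _ fun q =>
      substHom_levelPerm_eq hm (hv q)
        ((Nat.add_le_add_right (Nat.mul_le_mul_left m (hl q)) 1).trans hk2)] at this
    exact wordProd_levelPerm_substWord k this

theorem isDenselyRelated : IsDenselyRelated grigorchukGroup :=
  ⟨inferInstance, fun _ hfin hS =>
    (exists_relation hfin hS).elim fun _ h => isDenselyRelatedOver_of_exists_relation h⟩

end grigorchukGroup

/-! ### Asymptotic cones and gaps in the relation range -/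

section Grid

variable {G : Type*} [Group G] {S : Set G}

instance (n : ℤ) : (relationSubgroup S n).Normal := Subgroup.normalClosure_normal

theorem mk_eq_one_of_freeLength_le {w : FreeGroup S} {n : ℕ} (hw : evalHom S w = 1)
    (hn : freeLength w ≤ n) : (w : FreeGroup S ⧸ relationSubgroup S (n : ℤ)) = 1 :=
  (QuotientGroup.eq_one_iff w).2 (mem_relationSubgroup hw (by exact_mod_cast hn))

/-- A discrete homotopy of loops in `G` through squares of perimeter at most `n` does not change
the lift of a loop to the quotient of the free group by the relations of length at most `n`. -/
theorem eq_of_grid (hS : Subgroup.closure S = ⊤) {n m M : ℕ} {e : G} (g : ℕ → ℕ → G)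
    (P : ℕ → FreeGroup S ⧸ relationSubgroup S (n : ℤ))
    (hP : ∀ j < m, ∃ h : FreeGroup S, 4 * freeLength h ≤ n ∧
      evalHom S h = (g 0 j)⁻¹ * g 0 (j + 1) ∧ P (j + 1) = P j * h)
    (hhor : ∀ i < M, ∀ j < m, 4 * wordLength S ((g (i + 1) j)⁻¹ * g (i + 1) (j + 1)) ≤ n)
    (hver : ∀ i < M, ∀ j ≤ m, 4 * wordLength S ((g i j)⁻¹ * g (i + 1) j) ≤ n)
    (hleft : ∀ i ≤ M, g i 0 = e) (hright : ∀ i ≤ M, g i m = e) (htop : ∀ j ≤ m, g M j = e) :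
    P m = P 0 := by
  induction M generalizing g P with
  | zero =>
    have key : ∀ j ≤ m, P j = P 0 := by
      intro j
      induction j with
      | zero => simp
      | succ j ih =>
        intro hj
        obtain ⟨h, hl, hev, hstep⟩ := hP j hj
        rw [htop j (by omega), htop (j + 1) hj, inv_mul_cancel] at hev
        rw [hstep, mk_eq_one_of_freeLength_le hev (by omega), mul_one, ih (by omega)]
    exact key m le_rfl
  | succ M ih =>
    choose geo hev hgeo using exists_freeLength_eq hS
    -- The lift of the next row is obtained by following the vertical edges, labelled by geodesic
    -- words; at both ends these words are short relations, trivial in the quotient.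
    set v : ℕ → FreeGroup S := fun j => geo ((g 0 j)⁻¹ * g 1 j) with hv
    have hv1 (j : ℕ) (hj : j ≤ m) (h0 : g 0 j = e) (h1 : g 1 j = e) :
        (v j : FreeGroup S ⧸ relationSubgroup S (n : ℤ)) = 1 := by
      refine mk_eq_one_of_freeLength_le (by rw [hv, hev, h0, h1, inv_mul_cancel]) ?_
      have := hver 0 M.succ_pos j hj
      rw [hv, hgeo]
      rw [zero_add] at this
      omega
    have := ih (fun i => g (i + 1)) (fun j => P j * v j) (fun j hj => ?_)
      (fun i hi => hhor (i + 1) (by omega)) (fun i hi => hver (i + 1) (by omega))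
      (fun i hi => hleft (i + 1) (by omega)) (fun i hi => hright (i + 1) (by omega)) htop
    · rwa [hv1 m le_rfl (hright 0 (by omega)) (hright 1 (by omega)),
        hv1 0 (by omega) (hleft 0 (by omega)) (hleft 1 (by omega)), mul_one, mul_one] at this
    · obtain ⟨h, hl, hh, hstep⟩ := hP j hj
      have hl1 := hhor 0 M.succ_pos j hj
      have hl2 := hver 0 M.succ_pos j hj.le
      have hl3 := hver 0 M.succ_pos (j + 1) hj
      refine ⟨geo ((g 1 j)⁻¹ * g 1 (j + 1)), by rwa [hgeo], hev _, ?_⟩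
      -- The boundary of a square is a relation of length at most `n`, each side being at most `n /
      -- 4`.
      have hsq : ((h * v (j + 1) * (v j * geo ((g 1 j)⁻¹ * g 1 (j + 1)))⁻¹ : FreeGroup S) :
          FreeGroup S ⧸ relationSubgroup S (n : ℤ)) = 1 := by
        refine mk_eq_one_of_freeLength_le ?_ ?_
        · simp only [map_mul, map_inv, hh, hv, hev]
          group
        · have h1 := freeLength_mul_le (h * v (j + 1))
            (v j * geo ((g 1 j)⁻¹ * g 1 (j + 1)))⁻¹
          have h2 := freeLength_mul_le h (v (j + 1))
          have h3 := freeLength_mul_le (v j) (geo ((g 1 j)⁻¹ * g 1 (j + 1)))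
          rw [freeLength_inv] at h1
          simp only [hv, hgeo, zero_add] at *
          omega
      rw [QuotientGroup.mk_mul, QuotientGroup.mk_inv, mul_inv_eq_one] at hsq
      rw [hstep, mul_assoc, mul_assoc, ← QuotientGroup.mk_mul, hsq, QuotientGroup.mk_mul]

end Grid

/-- The prefix of length `i` of a word. -/
def wordPrefix {α : Type*} (L : List (α × Bool)) (i : ℕ) : FreeGroup α := FreeGroup.mk (L.take i)

theorem exists_wordPrefix_eq {G : Type*} {S : Set G} (L : List (S × Bool)) {i j : ℕ} (hij : i ≤ j) :
    ∃ h : FreeGroup S, freeLength h ≤ j - i ∧ wordPrefix L j = wordPrefix L i * h := by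
  refine ⟨FreeGroup.mk ((L.take j).drop i), (freeLength_mk_le _).trans (by simp; omega), ?_⟩
  rw [wordPrefix, wordPrefix, FreeGroup.mul_mk]
  conv_lhs => rw [← List.take_append_drop i (L.take j), List.take_take, min_eq_left hij]

/-! ### Paths in the group and their limit loops in the cone. -/

section Cone

variable {G : Type*} [Group G] {S : Set G} {hS : Subgroup.closure S = ⊤}

theorem WordMetricSpace.dist_eq (x y : WordMetricSpace S hS) :
    dist x y = (wordLength S ((show G from x)⁻¹ * (show G from y)) : ℝ) := rfl

theorem mul_inv_mul_mul_mul (a b c : G) : (a * b)⁻¹ * (a * (b * c)) = c := by group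

/-- The points of the path in `G` that starts at `e` and is labelled by a word. -/
def pathPoint (hS : Subgroup.closure S = ⊤) (e : WordMetricSpace S hS) (L : List (S × Bool))
    (i : ℕ) : WordMetricSpace S hS :=
  show G from (show G from e) * evalHom S (wordPrefix L i)

theorem pathPoint_zero (e : WordMetricSpace S hS) (L : List (S × Bool)) :
    pathPoint hS e L 0 = e := by
  have h : evalHom S (wordPrefix L 0) = 1 := by simp [wordPrefix, ← FreeGroup.one_eq_mk]
  exact (congrArg ((show G from e) * ·) h).trans (mul_one _)

theorem pathPoint_of_length_le (e : WordMetricSpace S hS) {L : List (S × Bool)}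
    (hL : evalHom S (FreeGroup.mk L) = 1) {i : ℕ} (hi : L.length ≤ i) :
    pathPoint hS e L i = e := by
  have h : evalHom S (wordPrefix L i) = 1 := by rw [wordPrefix, List.take_of_length_le hi, hL]
  exact (congrArg ((show G from e) * ·) h).trans (mul_one _)

theorem dist_pathPoint_le (e : WordMetricSpace S hS) (L : List (S × Bool)) (i j : ℕ) :
    dist (pathPoint hS e L i) (pathPoint hS e L j) ≤ |(i : ℝ) - j| := by
  wlog hij : i ≤ j generalizing i j
  · rw [dist_comm, abs_sub_comm]
    exact this j i (le_of_not_ge hij)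
  obtain ⟨h, hl, heq⟩ := exists_wordPrefix_eq L hij
  rw [abs_sub_comm, abs_of_nonneg (by simpa using hij), ← Nat.cast_sub hij,
    WordMetricSpace.dist_eq, Nat.cast_le]
  refine le_trans ?_ hl
  change wordLength S (((show G from e) * evalHom S (wordPrefix L i))⁻¹ *
    ((show G from e) * evalHom S (wordPrefix L j))) ≤ _
  rw [heq, map_mul]
  exact (congrArg _ (mul_inv_mul_mul_mul _ _ _)).trans_le (wordLength_le h)

theorem abs_floor_sub_floor_le {x y : ℝ} (hx : 0 ≤ x) (hy : 0 ≤ y) :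
    |(⌊x⌋₊ : ℝ) - ⌊y⌋₊| ≤ |x - y| + 1 := by
  have h1 := Nat.floor_le hx
  have h2 := Nat.floor_le hy
  have h3 := Nat.lt_floor_add_one x
  have h4 := Nat.lt_floor_add_one y
  have h5 := le_abs_self (x - y)
  have h6 := neg_abs_le (x - y)
  rw [abs_le]
  constructor <;> linarith

variable {ω : Ultrafilter ℕ} {s : ℕ → ℝ} {hs : ∀ n, 0 < s n} {e : ℕ → WordMetricSpace S hS}

/-- The sequence in `G` whose class is the limit at time `t` of the paths labelled by the words
`L n`, travelled at speed `c * s n`. -/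
noncomputable def limitLoop (ω : Ultrafilter ℕ) (hs : ∀ n, 0 < s n)
    (e : ℕ → WordMetricSpace S hS) (L : ℕ → List (S × Bool)) (c : ℕ) (t : unitInterval) :
    ConeSequence ω e s hs where
  seq n := pathPoint hS (e n) (L n) ⌊(t : ℝ) * (c * s n)⌋₊
  bounded := by
    refine ⟨c, Eventually.of_forall fun n => ?_⟩
    have hcs : 0 ≤ c * s n := by have := (hs n).le; positivity
    rw [div_le_iff₀ (hs n)]
    calc dist (pathPoint hS (e n) (L n) ⌊(t : ℝ) * (c * s n)⌋₊) (e n)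
        = dist (pathPoint hS (e n) (L n) ⌊(t : ℝ) * (c * s n)⌋₊)
            (pathPoint hS (e n) (L n) 0) := by rw [pathPoint_zero]
      _ ≤ |(⌊(t : ℝ) * (c * s n)⌋₊ : ℝ) - (0 : ℕ)| := dist_pathPoint_le _ _ _ _
      _ = ⌊(t : ℝ) * (c * s n)⌋₊ := by simp
      _ ≤ t * (c * s n) := Nat.floor_le (mul_nonneg t.2.1 hcs)
      _ ≤ c * s n := mul_le_of_le_one_left hcs t.2.2

/-- The paths are `c`-Lipschitz after rescaling, up to a rounding error `1 / s n` that vanishes in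
the limit. -/
theorem continuous_limitLoop (hlim : Tendsto s ω atTop) (L : ℕ → List (S × Bool)) (c : ℕ) :
    Continuous (limitLoop ω hs e L c) := by
  refine (LipschitzWith.of_dist_le_mul (K := c) fun t u => ?_).continuous
  have hlim' : Tendsto (fun n => (c : ℝ) * dist t u + 1 / s n) ω (𝓝 (c * dist t u + 0)) :=
    tendsto_const_nhds.add (tendsto_const_nhds.div_atTop hlim)
  rw [add_zero] at hlim'
  refine le_of_tendsto_of_tendsto (ConeSequence.tendsto_coneDist _ _) hlim'
    (Eventually.of_forall fun n => ?_)
  have hcs : 0 ≤ c * s n := by have := (hs n).le; positivity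
  change dist (pathPoint hS (e n) (L n) _) (pathPoint hS (e n) (L n) _) / s n ≤ _
  rw [div_le_iff₀ (hs n), add_mul, one_div_mul_cancel (hs n).ne']
  refine (dist_pathPoint_le _ _ _ _).trans
    ((abs_floor_sub_floor_le (mul_nonneg t.2.1 hcs) (mul_nonneg u.2.1 hcs)).trans_eq ?_)
  rw [← sub_mul, abs_mul, abs_of_nonneg hcs, Subtype.dist_eq, Real.dist_eq]
  ring

/-- The point `j / m` of the unit interval. -/
noncomputable def subdivision (m j : ℕ) : unitInterval :=
  Set.projIcc 0 1 zero_le_one ((j : ℝ) / m)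

theorem subdivision_zero (m : ℕ) : subdivision m 0 = 0 := by
  simp [subdivision]

theorem subdivision_self {m : ℕ} (hm : 0 < m) : subdivision m m = 1 := by
  rw [subdivision, div_self (by positivity)]
  exact Set.projIcc_right (zero_le_one' ℝ)

theorem subdivision_mono (m : ℕ) : Monotone (subdivision m) := fun i j hij => by
  have h : (i : ℝ) / m ≤ j / m := by gcongr
  exact Set.monotone_projIcc _ h

theorem dist_subdivision_le (m j : ℕ) :
    dist (subdivision m j) (subdivision m (j + 1)) ≤ 1 / m := by
  have h := (LipschitzWith.projIcc (a := (0 : ℝ)) (b := 1) zero_le_one).dist_le_mul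
    ((j : ℝ) / m) (((j + 1 : ℕ) : ℝ) / m)
  refine h.trans_eq ?_
  rw [Real.dist_eq, ← sub_div, NNReal.coe_one, one_mul, abs_div]
  simp

/-- If at every scale there is a relation that does not follow from relations of smaller size, then
no asymptotic cone is simply connected. -/
theorem not_simplyConnectedSpace_asymptoticCone {c : ℕ}
    (h : ∀ n : ℕ, 1 ≤ n → ∃ w : FreeGroup S, evalHom S w = 1 ∧ freeLength w ≤ c * n ∧
      w ∉ relationSubgroup S (n : ℤ)) (hlim : Tendsto s ω atTop) :
    ¬ SimplyConnectedSpace (AsymptoticCone ω e s hs) := by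
  intro hsc
  -- The empty word is a default for `⌊s n⌋₊ = 0`, which is excluded for the index `n` chosen in the
  -- end.
  have hL (n : ℕ) : ∃ L : List (S × Bool), evalHom S (FreeGroup.mk L) = 1 ∧
      L.length ≤ c * ⌊s n⌋₊ ∧
      (1 ≤ ⌊s n⌋₊ → FreeGroup.mk L ∉ relationSubgroup S (⌊s n⌋₊ : ℤ)) := by
    by_cases hn : 1 ≤ ⌊s n⌋₊
    · obtain ⟨w, h1, h2, h3⟩ := h _ hn
      obtain ⟨L, rfl, hL⟩ := exists_mk_eq w
      exact ⟨L, h1, hL.trans_le h2, fun _ => h3⟩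
    · exact ⟨[], by simp [← FreeGroup.one_eq_mk], by simp, fun h => absurd h hn⟩
  choose L hL1 hL2 hL3 using hL
  have hlen (n : ℕ) : (L n).length ≤ ⌊c * s n⌋₊ := by
    refine (hL2 n).trans (Nat.le_floor ?_)
    rw [Nat.cast_mul]
    exact mul_le_mul_of_nonneg_left (Nat.floor_le (hs n).le) c.cast_nonneg
  let x₀ : ConeSequence ω e s hs := ⟨e, 0, Eventually.of_forall fun n => by simp⟩
  let loop := limitLoop ω hs e L c
  have hloop0 : loop 0 = x₀ := by
    change ConeSequence.mk _ _ = ConeSequence.mk _ _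
    congr 1
    ext n
    simp [pathPoint_zero]
  have hloop1 : loop 1 = x₀ := by
    change ConeSequence.mk _ _ = ConeSequence.mk _ _
    congr 1
    ext n
    simp [pathPoint_of_length_le (e n) (hL1 n) (hlen n)]
  let γ : Path (SeparationQuotient.mk x₀) (SeparationQuotient.mk x₀) :=
    { toFun := fun t => SeparationQuotient.mk (loop t)
      continuous_toFun := SeparationQuotient.continuous_mk.comp (continuous_limitLoop hlim L c)
      source' := by rw [hloop0]
      target' := by rw [hloop1] }
  obtain ⟨H⟩ := SimplyConnectedSpace.paths_homotopic γ (Path.refl _)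
  obtain ⟨δ, hδ, hH⟩ := Metric.uniformContinuous_iff.1
    (CompactSpace.uniformContinuous_of_continuous H.continuous) (1 / 16) (by norm_num)
  -- The bound `1 / δ` makes the homotopy vary by less than `1 / 16` along each edge; the bound `16
  -- * c` makes each piece of the loop have length about `s n / 16` at most.
  obtain ⟨m, hm⟩ := exists_nat_gt (max (1 / δ) (16 * c))
  have hm0 : (0 : ℝ) < m := (lt_of_lt_of_le (by positivity) (le_max_left _ _)).trans hm
  have hmδ : 1 / (m : ℝ) < δ := by
    have := (le_max_left _ _).trans_lt hm
    rwa [one_div_lt hm0 hδ]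
  have hmc : 16 * c * (1 / (m : ℝ)) ≤ 1 := by
    have := ((le_max_right _ _).trans_lt hm).le
    rw [mul_one_div]
    exact div_le_one_of_le₀ this hm0.le
  have hm0' : 0 < m := by exact_mod_cast hm0
  set τ := subdivision m with hτ
  have hτ0 : τ 0 = 0 := subdivision_zero m
  have hτ1 : τ m = 1 := subdivision_self hm0'
  classical
  -- The base point is lifted to `x₀` itself, so that the sides and the top of the grid are exactly
  -- `e n`.
  let lift (p : AsymptoticCone ω e s hs) : ConeSequence ω e s hs :=
    if p = SeparationQuotient.mk x₀ then x₀
    else (SeparationQuotient.surjective_mk p).choose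
  have hlift (p) : SeparationQuotient.mk (lift p) = p := by
    by_cases hp : p = SeparationQuotient.mk x₀
    · simp [lift, hp]
    · simp only [lift, hp, if_false]
      exact (SeparationQuotient.surjective_mk p).choose_spec
  have hlift0 : lift (SeparationQuotient.mk x₀) = x₀ := by simp [lift]
  -- Row 0 keeps the actual points of the labelled path. Row 1 consists of arbitrary representatives
  -- of the same points of the cone, at limit distance 0 from row 0; hence the grid has one extra
  -- row.
  let grid : ℕ → ℕ → ConeSequence ω e s hs := fun i j =>
    Nat.casesOn i (loop (τ j)) fun i => lift (H (τ i, τ j))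
  have hgrid0 (j : ℕ) : grid 0 j = loop (τ j) := rfl
  have hgrid (i j : ℕ) : grid (i + 1) j = lift (H (τ i, τ j)) := rfl
  have hev {x y : ConeSequence ω e s hs}
      (hxy : dist (SeparationQuotient.mk x) (SeparationQuotient.mk y) < 1 / 16) :
      ∀ᶠ n in ω, dist (x.seq n) (y.seq n) / s n < 1 / 16 :=
    (ConeSequence.tendsto_coneDist x y).eventually_lt_const hxy
  have hhor (i j : ℕ) : ∀ᶠ n in ω,
      dist ((grid (i + 1) j).seq n) ((grid (i + 1) (j + 1)).seq n) / s n < 1 / 16 := by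
    refine hev ?_
    rw [hgrid, hgrid, hlift, hlift]
    refine hH ?_
    rw [Prod.dist_eq, dist_self]
    exact max_lt hδ ((dist_subdivision_le m j).trans_lt hmδ)
  have hver (i j : ℕ) : ∀ᶠ n in ω,
      dist ((grid i j).seq n) ((grid (i + 1) j).seq n) / s n < 1 / 16 := by
    refine hev ?_
    cases i with
    | zero =>
      rw [hgrid0, hgrid, hlift, hτ0, H.apply_zero]
      change dist (SeparationQuotient.mk (loop (τ j))) (SeparationQuotient.mk (loop (τ j))) < _
      rw [dist_self]
      norm_num
    | succ i =>
      rw [hgrid, hgrid, hlift, hlift]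
      refine hH ?_
      rw [Prod.dist_eq, dist_self]
      exact max_lt ((dist_subdivision_le m i).trans_lt hmδ) hδ
  have hhor' : ∀ᶠ n in ω, ∀ i ∈ Set.Iic m, ∀ j ∈ Set.Iic m,
      dist ((grid (i + 1) j).seq n) ((grid (i + 1) (j + 1)).seq n) / s n < 1 / 16 :=
    (eventually_all_finite (Set.finite_Iic m)).2 fun i _ =>
      (eventually_all_finite (Set.finite_Iic m)).2 fun j _ => hhor i j
  have hver' : ∀ᶠ n in ω, ∀ i ∈ Set.Iic m, ∀ j ∈ Set.Iic m,
      dist ((grid i j).seq n) ((grid (i + 1) j).seq n) / s n < 1 / 16 :=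
    (eventually_all_finite (Set.finite_Iic m)).2 fun i _ =>
      (eventually_all_finite (Set.finite_Iic m)).2 fun j _ => hver i j
  -- Only finitely many edges are involved, so a single index `n` serves them all. The bound `8 ≤ s
  -- n` ensures `4 * (s n / 16 + 1) ≤ ⌊s n⌋₊`, rounding included.
  obtain ⟨n, hnh, hnv, hn8⟩ := (hhor'.and (hver'.and (hlim.eventually_ge_atTop 8))).exists
  have hfl := Nat.lt_floor_add_one (s n)
  have hsmall {x y : WordMetricSpace S hS} (hxy : dist x y / s n < 1 / 16) :
      4 * wordLength S ((show G from x)⁻¹ * (show G from y)) ≤ ⌊s n⌋₊ := by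
    rw [div_lt_iff₀ (hs n), WordMetricSpace.dist_eq] at hxy
    have : (4 * (wordLength S ((show G from x)⁻¹ * (show G from y))) : ℝ) ≤ ⌊s n⌋₊ := by linarith
    exact_mod_cast this
  have hn1 : 1 ≤ ⌊s n⌋₊ := Nat.le_floor (by norm_num; linarith)
  refine hL3 n hn1 ((QuotientGroup.eq_one_iff _).1 ?_)
  have hleft (i : ℕ) : (grid i 0).seq n = e n := by
    cases i with
    | zero => rw [hgrid0, hτ0, hloop0]
    | succ i => rw [hgrid, hτ0, H.source, hlift0]
  have hright (i : ℕ) : (grid i m).seq n = e n := by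
    cases i with
    | zero => rw [hgrid0, hτ1, hloop1]
    | succ i => rw [hgrid, hτ1, H.target, hlift0]
  have htop (j : ℕ) : (grid (m + 1) j).seq n = e n := by
    rw [hgrid, hτ1, H.apply_one]
    change (lift (SeparationQuotient.mk x₀)).seq n = _
    rw [hlift0]
  let idx : ℕ → ℕ := fun j => ⌊(τ j : ℝ) * (c * s n)⌋₊
  have hcs : 0 ≤ c * s n := by have := (hs n).le; positivity
  have key := eq_of_grid hS (n := ⌊s n⌋₊) (m := m) (M := m + 1) (e := (show G from e n))
    (fun i j => (show G from (grid i j).seq n)) (fun j => wordPrefix (L n) (idx j))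
    (fun j hj => ?_)
    (fun i hi j hj => hsmall (hnh i (Nat.lt_succ_iff.1 hi) j hj.le))
    (fun i hi j hj => hsmall (hnv i (Nat.lt_succ_iff.1 hi) j hj))
    (fun i _ => hleft i) (fun i _ => hright i) (fun j _ => htop j)
  · have h0 : wordPrefix (L n) (idx 0) = 1 := by
      simp [idx, hτ0, wordPrefix, ← FreeGroup.one_eq_mk]
    have h1 : wordPrefix (L n) (idx m) = FreeGroup.mk (L n) := by
      simp only [idx, hτ1, wordPrefix, Set.Icc.coe_one, one_mul]
      rw [List.take_of_length_le (hlen n)]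
    rwa [h0, h1] at key
  · have hmono : τ j ≤ τ (j + 1) := subdivision_mono m j.le_succ
    have hidx : idx j ≤ idx (j + 1) :=
      Nat.floor_mono (mul_le_mul_of_nonneg_right (by exact_mod_cast hmono) hcs)
    obtain ⟨w, hw, heq⟩ := exists_wordPrefix_eq (L n) hidx
    refine ⟨w, ?_, ?_, by rw [heq, QuotientGroup.mk_mul]⟩
    -- The term `s n / 16` comes from `16 * c ≤ m`, and the `+ 1` from the two integer parts.
    · have h1 : ((idx (j + 1) - idx j : ℕ) : ℝ) ≤ s n / 16 + 1 := by
        rw [Nat.cast_sub hidx]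
        refine (le_abs_self _).trans ((abs_floor_sub_floor_le (mul_nonneg (τ (j + 1)).2.1 hcs)
          (mul_nonneg (τ j).2.1 hcs)).trans ?_)
        rw [← sub_mul, abs_mul, abs_of_nonneg hcs, ← Real.dist_eq, ← Subtype.dist_eq, dist_comm]
        have h2 := mul_le_mul_of_nonneg_right (dist_subdivision_le m j) hcs
        have h3 := mul_le_mul_of_nonneg_right hmc (hs n).le
        rw [hτ]
        linarith
      have h2 : (freeLength w : ℝ) ≤ s n / 16 + 1 := le_trans (by exact_mod_cast hw) h1
      have h3 : (4 * freeLength w : ℝ) ≤ ⌊s n⌋₊ := by linarith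
      exact_mod_cast h3
    · change _ = ((show G from e n) * evalHom S (wordPrefix (L n) (idx j)))⁻¹ *
        ((show G from e n) * evalHom S (wordPrefix (L n) (idx (j + 1))))
      rw [heq, map_mul]
      exact (mul_inv_mul_mul_mul _ _ _).symm

end Cone

theorem mainTheorem6 :
    IsDenselyRelated ↥grigorchukGroup ∧
      ∀ (S : Set ↥grigorchukGroup) (_ : S.Finite) (hS : Subgroup.closure S = ⊤)
        (ω : Ultrafilter ℕ) (s : ℕ → ℝ) (hs : ∀ n, 0 < s n) (e : ℕ → WordMetricSpace S hS),
        Filter.Tendsto s (ω : Filter ℕ) Filter.atTop →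
          ¬ SimplyConnectedSpace (AsymptoticCone ω e s hs) := by
  refine ⟨grigorchukGroup.isDenselyRelated, fun S hfin hS ω s hs e hlim => ?_⟩
  obtain ⟨c, hc⟩ := grigorchukGroup.exists_relation hfin hS
  exact not_simplyConnectedSpace_asymptoticCone hc hlim
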